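/- **Definitions.** Let $v=(v_1,\dots,v_n)$ be vectors in $\mathbb R^d$ (repetitions allowed), and for $S\subseteq[n]$ with $|S|=k$ put $\mu_v(S)=\det\big(\sum_{i\in S}v_iv_i^\top\big)$. For $W\subseteq[n]$ let $\mathrm{OPT}_k(W)=\max\{\mu_v(S): S\subseteq W,\ |S|=k\}$, which is $0$ if $|W|<k$. A map $c$ that sends each $V\subseteq [n]$ to a subset $c(V)\subseteq V$ is an *$\alpha$-composable coreset* if for all $m$ and all $V_1,\dots,V_m\subseteq[n]$ $$\mathrm{OPT}_k\Big(\bigcup_i V_i\Big)\ \le\ \alpha\cdot \mathrm{OPT}_k\Big(\bigcup_i c(V_i)\Big),$$ and it has *size* $t$ if $|c(V)|\le t$ for all $V$. Say that *size $t$ forces factor $B$* (for $d,k$) if there are $n$ and $v_1,\dots,v_n\in\mathbb R^d$ such that every $\alpha$-composable coreset of size $t$ for this instance has $\alpha\ge B$. **Theorem.** Let $b:\mathbb N\to\mathbb R$ satisfy $b(d)=o(d/\log^2 d)$. 1. There is a sequence $\varepsilon_d\to0$, depending only on $b$, such that for all sufficiently large $d$ (also depending only on $b$), all integers $k$ and all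 real $\gamma$, $\gamma'>0$ with $d\le k\le d^{\gamma}$ and $\gamma\gamma'\le b(d)$, size $k^{\gamma'}$ forces factor $$\Big(\frac{d}{\gamma\gamma'\log^2 d}\Big)^{d(1-\varepsilon_d)} .$$ 2. If moreover $\log\log d=o\big(\log (d/b(d))\big)$ (for instance if $b(d)= d^{1-\delta}$ with fixed $0<\delta\le 1$), then the same holds, for some sequence $\varepsilon_d\to 0$ depending only on $b$, with the factor $$\Big(\frac{d}{\gamma\gamma'}\Big)^{d(1-\varepsilon_d)} .$$ 3. In particular, for fixed real $\gamma$ and $\gamma'>0$ there is $\varepsilon_d\to0$ such that for all sufficiently large $d$ and all integers $k$ with $d\le k\le d^{\gamma}$, size $k^{\gamma'}$ forces factor $d^{\,d(1-\varepsilon_d)}$. That is, when $k\le\mathrm{poly}(d)$ and the coreset size is $\mathrm{poly}(k)$, an approximation factor of the form $d^{O(d)}$ cannot be improved to $d^{o(d)}$. -/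

import Mathlib

open Filter Asymptotics

open scoped Topology NNReal

namespace DetCoreset

/-- The determinant objective `det (∑_{i ∈ S} v_i v_iᵀ)` of a set `S` of indices of
vectors `v_1, …, v_n` in `ℝ^d` (different indices may carry equal vectors). -/
noncomputable def detValue {n d : ℕ} (v : Fin n → Fin d → ℝ) (S : Finset (Fin n)) : ℝ :=
  (∑ i ∈ S, Matrix.vecMulVec (v i) (v i)).det

theorem detValue_nonneg {n d : ℕ} (v : Fin n → Fin d → ℝ) (S : Finset (Fin n)) :
    0 ≤ detValue v S := by
  refine (Matrix.posSemidef_sum S fun i _ => ?_).det_nonneg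
  simpa using Matrix.posSemidef_vecMulVec_self_star (v i)

/-- The determinant objective as a function with values in the nonnegative reals. -/
noncomputable def mu {n d : ℕ} (v : Fin n → Fin d → ℝ) (S : Finset (Fin n)) : ℝ≥0 :=
  ⟨detValue v S, detValue_nonneg v S⟩

/-- `max {f S : S ⊆ W, |S| = k}`. It is `0` if `W` has fewer than `k` elements. -/
noncomputable def opt {n : ℕ} (k : ℕ) (f : Finset (Fin n) → ℝ≥0) (W : Finset (Fin n)) : ℝ≥0 :=
  (W.powersetCard k).sup f

/-- `c` maps every set to one of its subsets, of cardinality at most `t`. -/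
def IsCoresetMap {n : ℕ} (t : ℝ) (c : Finset (Fin n) → Finset (Fin n)) : Prop :=
  ∀ V, c V ⊆ V ∧ ((c V).card : ℝ) ≤ t

/-- `c` is `α`-composable for maximizing `f` over the `k`-element subsets of `{1, …, n}`. -/
def IsComposable {n : ℕ} (k : ℕ) (f : Finset (Fin n) → ℝ≥0) (α : ℝ)
    (c : Finset (Fin n) → Finset (Fin n)) : Prop :=
  ∀ (m : ℕ) (V : Fin m → Finset (Fin n)),
    (opt k f (Finset.univ.biUnion V) : ℝ) ≤
      α * (opt k f (Finset.univ.biUnion fun i => c (V i)) : ℝ)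

/-- There is an instance `v_1, …, v_n ∈ ℝ^d` of determinant maximization over `k`-element subsets
for which each composable coreset of size `t` has approximation factor at least `B`. -/
def CoresetFactorAtLeast (d k : ℕ) (t B : ℝ) : Prop :=
  ∃ (n : ℕ) (v : Fin n → Fin d → ℝ), ∀ (c : Finset (Fin n) → Finset (Fin n)) (α : ℝ),
    IsCoresetMap t c → IsComposable k (mu v) α c → B ≤ α

end DetCoreset

/-!
The lower bound is a game against a fixed coreset map `c`, played one dimension at a time.

In `ℝ^D` take a family `G` of more than `t` sign vectors with `⟨x, y⟩² ≤ 4 log (2t) D` for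
`x ≠ y` (`exists_signVectors_avoiding`; a greedy choice works by a Chernoff bound). Since `c` keeps
at most `t` elements of `G`, it misses some `x ∈ G`, and everything it keeps has a small component
along `x`. (For `D ≤ 4 log (2t)` the bound holds for all sign vectors, and `x` need not be missed.)
Now continue with a copy of the `(D - 1)`-dimensional instance in the hyperplane `x^⊥`;
such a copy is provided for each `x ∈ G`, so the whole instance is finite (`HasHardFamily.succ`).
The missed vectors `x_1, …, x_d` of all the rounds are triangular with respect to the rounds: later
sets have no component along earlier missed vectors. Components of earlier sets along later missed
vectors are uncontrolled, but they become negligible by scaling the earlier sets down by a factor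
`η`, which can be chosen uniformly because there are only finitely many coreset maps. Hence there
are linear coordinates in which the missed vectors are multiples `β_j` of the basis vectors with
`∏ β_j² = d! / (4 log (2t)) ^ d`, while all vectors in the coresets have squared norm at most `2`.

Each vector is taken `k` times, so that `k` of the missed vectors can be spread evenly over the `d`
axes; this gives a diagonal matrix of determinant at least `⌊k / d⌋ ^ d ∏ β_j²`
(`le_detValue_of_eq_single`). On the other hand `k` vectors of squared norm at most `2` have
determinant at most `(2k / d) ^ d`, because `det A ≤ (tr A / d) ^ d` for positive semidefinite `A`
(`detValue_le_of_sum_sq_le`). The change of coordinates multiplies both values by the same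
constant, so the factor is at least `d! / (16 log (2t)) ^ d` (`HasHardFamily.coresetFactorAtLeast`).

For `t = k ^ γ'` with `γ' ≥ 1` this is at least `(d / (96 γ γ' log d)) ^ d`, and the statements
follow by comparing logarithms. For `γ' < 1` the coreset of a single set has fewer than `k` elements
and no finite factor is possible at all (`coresetFactorAtLeast_of_lt`).
-/

namespace DetCoreset

/-! ### Nearly orthogonal sign vectors -/

/-- The vectors in `ℝ^D` with all coordinates `1` or `-1`. -/
noncomputable def signVectors (D : ℕ) : Finset (Fin D → ℝ) :=
  Fintype.piFinset fun _ => {1, -1}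

theorem mem_signVectors {D : ℕ} {x : Fin D → ℝ} :
    x ∈ signVectors D ↔ ∀ i, x i = 1 ∨ x i = -1 := by
  simp [signVectors]

theorem card_signVectors (D : ℕ) : (signVectors D).card = 2 ^ D := by
  rw [signVectors, Fintype.card_piFinset_const, Finset.card_pair (by norm_num)]

theorem dotProduct_self_of_mem_signVectors {D : ℕ} {x : Fin D → ℝ} (hx : x ∈ signVectors D) :
    x ⬝ᵥ x = D := by
  have h : ∀ i, x i * x i = 1 := fun i => by
    rcases mem_signVectors.1 hx i with h | h <;> rw [h] <;> norm_num
  simp [dotProduct, h]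

/-- The moment generating function of a sum of `D` random signs. -/
theorem sum_exp_dotProduct_signVectors {D : ℕ} {x : Fin D → ℝ} (hx : x ∈ signVectors D) (s : ℝ) :
    ∑ y ∈ signVectors D, Real.exp (s * (x ⬝ᵥ y)) = (2 * Real.cosh s) ^ D := by
  have h : ∀ y : Fin D → ℝ, Real.exp (s * (x ⬝ᵥ y)) = ∏ i, Real.exp (s * (x i * y i)) := by
    intro y
    rw [← Real.exp_sum, dotProduct, Finset.mul_sum]
  simp_rw [h]
  rw [signVectors, Finset.sum_prod_piFinset ({1, -1} : Finset ℝ) fun i a => Real.exp (s * (x i * a)),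
    Finset.prod_congr rfl (g := fun _ => 2 * Real.cosh s), Finset.prod_const, Finset.card_univ,
    Fintype.card_fin]
  intro i _
  rw [Finset.sum_pair (by norm_num), Real.cosh_eq]
  rcases mem_signVectors.1 hx i with h | h <;> rw [h] <;> ring_nf

/-- Chernoff bound: few sign vectors have a large inner product with a given one. -/
theorem card_filter_dotProduct_sq_gt_le {D : ℕ} {x : Fin D → ℝ} (hx : x ∈ signVectors D)
    {δ : ℝ} (hδ : 0 ≤ δ) :
    (((signVectors D).filter fun y => δ * D ^ 2 < (x ⬝ᵥ y) ^ 2).card : ℝ) ≤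
      2 * 2 ^ D * Real.exp (-(δ * D / 2)) := by
  set s := √δ with hs
  have hs0 : 0 ≤ s := Real.sqrt_nonneg _
  have hs2 : s ^ 2 = δ := Real.sq_sqrt hδ
  have hmgf : ∀ r : ℝ, r ^ 2 = δ →
      ∑ y ∈ signVectors D, Real.exp (r * (x ⬝ᵥ y) - δ * D) ≤
        2 ^ D * Real.exp (-(δ * D / 2)) := by
    intro r hr
    simp_rw [sub_eq_add_neg, Real.exp_add]
    rw [← Finset.sum_mul, sum_exp_dotProduct_signVectors hx, mul_pow, mul_assoc]
    refine mul_le_mul_of_nonneg_left ?_ (by positivity)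
    calc Real.cosh r ^ D * Real.exp (-(δ * D))
        ≤ Real.exp (r ^ 2 / 2) ^ D * Real.exp (-(δ * D)) := by
          gcongr
          exact Real.cosh_le_exp_half_sq r
      _ = Real.exp (-(δ * D / 2)) := by
          rw [hr, ← Real.exp_nat_mul, ← Real.exp_add]
          ring_nf
  calc (((signVectors D).filter fun y => δ * D ^ 2 < (x ⬝ᵥ y) ^ 2).card : ℝ)
      = ∑ y ∈ (signVectors D).filter fun y => δ * D ^ 2 < (x ⬝ᵥ y) ^ 2, (1 : ℝ) := by simp
    _ ≤ ∑ y ∈ (signVectors D).filter fun y => δ * D ^ 2 < (x ⬝ᵥ y) ^ 2,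
          (Real.exp (s * (x ⬝ᵥ y) - δ * D) + Real.exp (-s * (x ⬝ᵥ y) - δ * D)) := by
        refine Finset.sum_le_sum fun y hy => ?_
        have h : (s * D) ^ 2 < (x ⬝ᵥ y) ^ 2 := by
          rw [mul_pow, hs2]
          exact (Finset.mem_filter.1 hy).2
        have h' : s * D ≤ |x ⬝ᵥ y| := by
          have := sq_lt_sq.1 h
          rw [abs_of_nonneg (by positivity)] at this
          exact this.le
        have hm : δ * D ≤ s * |x ⬝ᵥ y| := by
          rw [← hs2, sq, mul_assoc]
          exact mul_le_mul_of_nonneg_left h' hs0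
        rcases abs_cases (x ⬝ᵥ y) with ⟨he, _⟩ | ⟨he, _⟩ <;> rw [he] at hm
        · exact (Real.one_le_exp (by linarith)).trans
            (le_add_of_nonneg_right (Real.exp_pos _).le)
        · exact (Real.one_le_exp (by linarith)).trans
            (le_add_of_nonneg_left (Real.exp_pos _).le)
    _ ≤ ∑ y ∈ signVectors D,
          (Real.exp (s * (x ⬝ᵥ y) - δ * D) + Real.exp (-s * (x ⬝ᵥ y) - δ * D)) :=
        Finset.sum_le_sum_of_subset_of_nonneg (Finset.filter_subset _ _)
          fun _ _ _ => by positivity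
    _ ≤ 2 * 2 ^ D * Real.exp (-(δ * D / 2)) := by
        rw [Finset.sum_add_distrib]
        linarith [hmgf s hs2, hmgf (-s) (by rw [neg_sq, hs2])]

/-- Greedy choice of more than `t` sign vectors with small pairwise inner products. -/
theorem exists_nearly_orthogonal_signVectors {D : ℕ} {t δ : ℝ} (hD : 0 < D) (ht : 1 ≤ t)
    (hδ : 2 * Real.log (2 * t) < δ * D) (hδ1 : δ < 1) :
    ∃ G ⊆ signVectors D, t < G.card ∧
      ∀ x ∈ G, ∀ y ∈ G, x ≠ y → (x ⬝ᵥ y) ^ 2 ≤ δ * D ^ 2 := by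
  classical
  have hD' : (0 : ℝ) < D := by exact_mod_cast hD
  have hδ0 : 0 ≤ δ := by
    have : 0 ≤ Real.log (2 * t) := Real.log_nonneg (by linarith)
    by_contra! h
    nlinarith
  obtain ⟨G, hG, hmax⟩ := Finset.exists_max_image
    ((signVectors D).powerset.filter fun G =>
      ∀ x ∈ G, ∀ y ∈ G, x ≠ y → (x ⬝ᵥ y) ^ 2 ≤ δ * D ^ 2) Finset.card ⟨∅, by simp⟩
  rw [Finset.mem_filter, Finset.mem_powerset] at hG
  refine ⟨G, hG.1, ?_, hG.2⟩
  by_contra! hcard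
  set bad : Finset (Fin D → ℝ) :=
    G.biUnion fun x => (signVectors D).filter fun y => δ * D ^ 2 < (x ⬝ᵥ y) ^ 2 with hbad
  have hlt : bad.card < (signVectors D).card := by
    have h1 : (bad.card : ℝ) ≤ G.card * (2 * 2 ^ D * Real.exp (-(δ * D / 2))) := by
      calc (bad.card : ℝ)
          ≤ ∑ x ∈ G, (((signVectors D).filter fun y => δ * D ^ 2 < (x ⬝ᵥ y) ^ 2).card : ℝ) := by
            rw [← Nat.cast_sum, Nat.cast_le]
            exact Finset.card_biUnion_le
        _ ≤ ∑ x ∈ G, 2 * 2 ^ D * Real.exp (-(δ * D / 2)) :=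
            Finset.sum_le_sum fun x hx => card_filter_dotProduct_sq_gt_le (hG.1 hx) hδ0
        _ = _ := by rw [Finset.sum_const, nsmul_eq_mul]
    have h2 : 2 * t < Real.exp (δ * D / 2) := by
      rw [← Real.log_lt_iff_lt_exp (by linarith)]
      linarith
    have h3 : 2 * t * Real.exp (-(δ * D / 2)) < 1 := by
      rw [Real.exp_neg, ← div_eq_mul_inv, div_lt_one (Real.exp_pos _)]
      exact h2
    have h4 : (bad.card : ℝ) < 2 ^ D := by
      calc (bad.card : ℝ) ≤ t * (2 * 2 ^ D * Real.exp (-(δ * D / 2))) := by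
            refine h1.trans ?_
            gcongr
        _ = 2 ^ D * (2 * t * Real.exp (-(δ * D / 2))) := by ring
        _ < 2 ^ D * 1 := by gcongr
        _ = 2 ^ D := mul_one _
    rw [card_signVectors]
    exact_mod_cast h4
  obtain ⟨y, hy, hyb⟩ := Finset.exists_mem_notMem_of_card_lt_card hlt
  have hgood : ∀ x ∈ G, (x ⬝ᵥ y) ^ 2 ≤ δ * D ^ 2 := by
    intro x hx
    by_contra! h
    exact hyb (Finset.mem_biUnion.2 ⟨x, hx, Finset.mem_filter.2 ⟨hy, h⟩⟩)
  have hyG : y ∉ G := by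
    intro h
    have := hgood y h
    rw [dotProduct_self_of_mem_signVectors hy] at this
    nlinarith [sq_pos_of_pos hD']
  have := hmax (insert y G) (by
    rw [Finset.mem_filter, Finset.mem_powerset]
    refine ⟨Finset.insert_subset hy hG.1, ?_⟩
    intro a ha b hb hab
    rcases Finset.mem_insert.1 ha with rfl | ha' <;> rcases Finset.mem_insert.1 hb with rfl | hb'
    · exact absurd rfl hab
    · rw [dotProduct_comm]
      exact hgood b hb'
    · exact hgood a ha'
    · exact hG.2 a ha' b hb' hab)
  rw [Finset.card_insert_of_notMem hyG] at this
  omega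

/-- A family of sign vectors such that any `t` of its members are nearly orthogonal to some
member. In dimensions `D ≤ 4 log (2t)` the bound is the trivial one. -/
theorem exists_signVectors_avoiding {D : ℕ} {t : ℝ} (hD : 0 < D) (ht : 1 ≤ t) :
    ∃ G ⊆ signVectors D, ∀ T ⊆ G, (T.card : ℝ) ≤ t →
      ∃ x ∈ G, ∀ y ∈ T, (x ⬝ᵥ y) ^ 2 ≤ 4 * Real.log (2 * t) * D := by
  have hD' : (0 : ℝ) < D := by exact_mod_cast hD
  have hlog : 0 < Real.log (2 * t) := Real.log_pos (by linarith)
  rcases le_or_gt (D : ℝ) (4 * Real.log (2 * t)) with h | h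
  · have h1 : (fun _ => 1 : Fin D → ℝ) ∈ signVectors D := mem_signVectors.2 fun _ => Or.inl rfl
    refine ⟨{fun _ => 1}, Finset.singleton_subset_iff.2 h1, fun T hT _ =>
      ⟨_, Finset.mem_singleton_self _, fun y hy => ?_⟩⟩
    rw [Finset.mem_singleton.1 (hT hy), dotProduct_self_of_mem_signVectors h1, sq]
    gcongr
  · obtain ⟨G, hG, hcard, hdot⟩ := exists_nearly_orthogonal_signVectors hD ht
      (δ := 4 * Real.log (2 * t) / D) (by rw [div_mul_cancel₀ _ hD'.ne']; linarith)
      ((div_lt_one hD').2 h)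
    refine ⟨G, hG, fun T hT hTt => ?_⟩
    obtain ⟨x, hx, hxT⟩ := Finset.exists_mem_notMem_of_card_lt_card
      (s := T) (t := G) (by exact_mod_cast hTt.trans_lt hcard)
    refine ⟨x, hx, fun y hy => (hdot x hx y (hT hy) ?_).trans_eq ?_⟩
    · rintro rfl
      exact hxT hy
    · field_simp

/-! ### Determinants of sums of rank-one matrices -/

/-- The inequality of arithmetic and geometric means for the eigenvalues. -/
theorem det_le_trace_div_pow {d : ℕ} {A : Matrix (Fin d) (Fin d) ℝ} (hA : A.PosSemidef) :
    A.det ≤ (A.trace / d) ^ d := by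
  rcases Nat.eq_zero_or_pos d with rfl | hd
  · simp
  have hd' : (0 : ℝ) < d := by exact_mod_cast hd
  have h := Real.geom_mean_le_arith_mean Finset.univ (fun _ : Fin d => (1 : ℝ))
    hA.1.eigenvalues (fun _ _ => zero_le_one) (by simpa using hd)
    (fun i _ => hA.eigenvalues_nonneg i)
  have h0 : 0 ≤ ∏ i, hA.1.eigenvalues i := Finset.prod_nonneg fun i _ => hA.eigenvalues_nonneg i
  simp only [Real.rpow_one, one_mul, Finset.sum_const, Finset.card_univ, Fintype.card_fin,
    nsmul_eq_mul, mul_one] at h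
  rw [hA.1.det_eq_prod_eigenvalues, hA.1.trace_eq_sum_eigenvalues]
  simp only [RCLike.ofReal_real_eq_id, id_eq]
  calc ∏ i, hA.1.eigenvalues i = ((∏ i, hA.1.eigenvalues i) ^ (d : ℝ)⁻¹) ^ d :=
        (Real.rpow_inv_natCast_pow h0 hd.ne').symm
    _ ≤ _ := by gcongr

/-- Applying a matrix to the vectors multiplies the objective by the square of its determinant. -/
theorem detValue_mulVec {n d : ℕ} (P : Matrix (Fin d) (Fin d) ℝ) (v : Fin n → Fin d → ℝ)
    (S : Finset (Fin n)) :
    detValue (fun i => P.mulVec (v i)) S = P.det ^ 2 * detValue v S := by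
  have h : ∑ i ∈ S, Matrix.vecMulVec (P.mulVec (v i)) (P.mulVec (v i)) =
      P * (∑ i ∈ S, Matrix.vecMulVec (v i) (v i)) * P.transpose := by
    rw [Finset.mul_sum, Finset.sum_mul]
    refine Finset.sum_congr rfl fun i _ => ?_
    rw [Matrix.mul_vecMulVec, Matrix.vecMulVec_mul, Matrix.vecMul_transpose]
  rw [detValue, h, Matrix.det_mul, Matrix.det_mul, Matrix.det_transpose, detValue]
  ring

theorem detValue_le_of_sum_sq_le {n d k : ℕ} (v : Fin n → Fin d → ℝ) (S : Finset (Fin n))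
    (hS : S.card = k) {r : ℝ} (hv : ∀ i ∈ S, ∑ j, v i j ^ 2 ≤ r) :
    detValue v S ≤ (k * r / d) ^ d := by
  have hpsd : (∑ i ∈ S, Matrix.vecMulVec (v i) (v i)).PosSemidef :=
    Matrix.posSemidef_sum S fun i _ => by
      simpa using Matrix.posSemidef_vecMulVec_self_star (v i)
  refine (det_le_trace_div_pow hpsd).trans ?_
  have h0 := hpsd.trace_nonneg
  have : (∑ i ∈ S, Matrix.vecMulVec (v i) (v i)).trace ≤ k * r := by
    rw [Matrix.trace_sum, ← hS, ← nsmul_eq_mul]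
    refine Finset.sum_le_card_nsmul _ _ _ fun i hi => ?_
    refine le_of_eq_of_le ?_ (hv i hi)
    simp [Matrix.trace_vecMulVec, dotProduct, sq]
  gcongr

/-- Vectors on the coordinate axes, at least `q` on each axis, have a diagonal matrix. -/
theorem le_detValue_of_eq_single {n d k : ℕ} (hd : 0 < d) (v : Fin n → Fin d → ℝ)
    (e : Fin k ↪ Fin n) (β : Fin d → ℝ)
    (hv : ∀ i, v (e i) = Pi.single ⟨i % d, Nat.mod_lt _ hd⟩ (β ⟨i % d, Nat.mod_lt _ hd⟩)) :
    ((k / d : ℕ) : ℝ) ^ d * ∏ j, β j ^ 2 ≤ detValue v (Finset.univ.map e) := by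
  classical
  have h : ∑ i ∈ Finset.univ.map e, Matrix.vecMulVec (v i) (v i) = Matrix.diagonal fun j : Fin d =>
      ((Finset.univ.filter fun i : Fin k => (i : ℕ) % d = (j : ℕ)).card : ℝ) * β j ^ 2 := by
    ext a b
    rw [Finset.sum_map, Matrix.sum_apply]
    simp only [Matrix.vecMulVec_apply, hv, Matrix.diagonal_apply]
    by_cases hab : a = b
    · subst hab
      rw [if_pos rfl, Finset.card_eq_sum_ones, Nat.cast_sum, Finset.sum_mul, Finset.sum_filter]
      refine Finset.sum_congr rfl fun i _ => ?_
      by_cases hi : (i : ℕ) % d = a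
      · have : (⟨i % d, Nat.mod_lt _ hd⟩ : Fin d) = a := Fin.ext hi
        rw [if_pos hi, this, Pi.single_eq_same]
        push_cast
        ring
      · have : a ≠ (⟨i % d, Nat.mod_lt _ hd⟩ : Fin d) := fun h => hi (by rw [h])
        rw [if_neg hi, Pi.single_eq_of_ne this, zero_mul]
    · rw [if_neg hab]
      refine Finset.sum_eq_zero fun i _ => ?_
      by_cases ha : a = (⟨i % d, Nat.mod_lt _ hd⟩ : Fin d)
      · rw [Pi.single_eq_of_ne (i' := b) (fun hb => hab (ha.trans hb.symm)), mul_zero]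
      · rw [Pi.single_eq_of_ne ha, zero_mul]
  rw [detValue, h, Matrix.det_diagonal, Finset.prod_mul_distrib]
  refine mul_le_mul_of_nonneg_right ?_ (Finset.prod_nonneg fun j _ => sq_nonneg _)
  calc ((k / d : ℕ) : ℝ) ^ d = ∏ _j : Fin d, ((k / d : ℕ) : ℝ) := by simp
    _ ≤ _ := Finset.prod_le_prod (fun _ _ => Nat.cast_nonneg _) fun j _ => by
      have hlt : ∀ a : Fin (k / d), a * d + j < k := fun a => by
        have h1 : (a + 1) * d ≤ k :=
          (Nat.mul_le_mul_right d a.2).trans (Nat.div_mul_le_self k d)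
        have := j.2
        linarith
      have := Finset.card_le_card_of_injOn (s := (Finset.univ : Finset (Fin (k / d))))
        (t := Finset.univ.filter fun i : Fin k => (i : ℕ) % d = (j : ℕ))
        (fun a => ⟨a * d + j, hlt a⟩)
        (fun a _ => by simp [Nat.mod_eq_of_lt j.2])
        (fun a _ b _ hab => by
          have := congrArg Fin.val hab
          exact Fin.ext (Nat.eq_of_mul_eq_mul_right hd (by simpa using this)))
      rw [Finset.card_univ, Fintype.card_fin] at this
      exact_mod_cast this

/-! ### The recursive instance -/

/-- Linear coordinates in which the sign vector `x` is the first basis vector and the first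
coordinate is the normalized inner product with `x`. -/
theorem exists_linearEquiv_of_mem_signVectors {D : ℕ} {x : Fin (D + 1) → ℝ}
    (hx : x ∈ signVectors (D + 1)) :
    ∃ e : (Fin (D + 1) → ℝ) ≃ₗ[ℝ] ℝ × (Fin D → ℝ),
      e x = (1, 0) ∧ ∀ y, (e y).1 = (x ⬝ᵥ y) / (D + 1 : ℕ) := by
  have hself := dotProduct_self_of_mem_signVectors hx
  have hD : ((D + 1 : ℕ) : ℝ) ≠ 0 := by positivity
  have hx0 : x 0 ≠ 0 := by
    rcases mem_signVectors.1 hx 0 with h | h <;> rw [h] <;> norm_num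
  let f : (Fin (D + 1) → ℝ) →ₗ[ℝ] ℝ × (Fin D → ℝ) :=
    { toFun := fun y => ((x ⬝ᵥ y) / (D + 1 : ℕ), fun i => y i.succ - x i.succ / x 0 * y 0)
      map_add' := fun y z => by
        ext
        · simp [dotProduct_add, add_div]
        · simp only [Pi.add_apply, Prod.snd_add]
          ring
      map_smul' := fun a y => by
        ext
        · simp [dotProduct_smul, mul_div_assoc]
        · simp only [Pi.smul_apply, Prod.smul_snd, smul_eq_mul, RingHom.id_apply]
          ring }
  have hf : Function.Injective f := by
    rw [← LinearMap.ker_eq_bot, LinearMap.ker_eq_bot']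
    intro y hy
    have h1 : x ⬝ᵥ y = 0 := by
      have : (x ⬝ᵥ y) / (D + 1 : ℕ) = 0 := congrArg Prod.fst hy
      rwa [div_eq_zero_iff, or_iff_left hD] at this
    have h2 : ∀ i : Fin D, y i.succ - x i.succ / x 0 * y 0 = 0 := fun i =>
      congrFun (congrArg Prod.snd hy) i
    have h3 : y = (y 0 / x 0) • x := by
      ext i
      refine Fin.cases ?_ (fun i => ?_) i
      · simp [hx0]
      · rw [Pi.smul_apply, smul_eq_mul]
        linear_combination h2 i
    rw [h3, dotProduct_smul, hself, smul_eq_mul, mul_eq_zero, or_iff_left hD] at h1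
    rw [h3, h1, zero_smul]
  refine ⟨LinearEquiv.ofInjectiveOfFinrankEq f hf (by simp [add_comm]), ?_, fun y => rfl⟩
  change f x = (1, 0)
  refine Prod.ext ?_ (funext fun i => ?_)
  · change (x ⬝ᵥ x) / (D + 1 : ℕ) = 1
    rw [hself, div_self hD]
  · change x i.succ - x i.succ / x 0 * x 0 = 0
    field_simp
    ring

/-- A finite family of vectors `v` in `ℝ^d`, each of which is taken `k` times, is *`ρ`-hard* for
size `t` if for each coreset map of size `t` there are sets `V_1, …, V_d`, with vectors `x_j` all
of whose copies are in `V_j`, and linear coordinates `P` of `ℝ^d` in which `x_j` is `β_j` times the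
`j`-th basis vector, `∏ β_j² = ρ`, while all vectors in the coresets of the `V_j` have squared norm
at most `2`. -/
def HasHardFamily (k d : ℕ) (t ρ : ℝ) : Prop :=
  ∃ (κ : Type) (_ : Fintype κ) (v : κ → Fin d → ℝ) (β : Fin d → ℝ),
    ∏ j, β j ^ 2 = ρ ∧ ∀ c : Finset (κ × Fin k) → Finset (κ × Fin k),
      (∀ V, c V ⊆ V ∧ ((c V).card : ℝ) ≤ t) →
        ∃ (P : (Fin d → ℝ) ≃ₗ[ℝ] (Fin d → ℝ)) (V : Fin d → Finset (κ × Fin k)) (x : Fin d → κ),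
          (∀ j i, (x j, i) ∈ V j) ∧ (∀ j, P (v (x j)) = Pi.single j (β j)) ∧
            ∀ j, ∀ y ∈ c (V j), ∑ l, P (v y.1) l ^ 2 ≤ 2

theorem hasHardFamily_zero (k : ℕ) (t : ℝ) : HasHardFamily k 0 t 1 :=
  ⟨Empty, inferInstance, fun _ => 0, 0, by simp, fun _ _ =>
    ⟨LinearEquiv.refl ℝ _, fun j => j.elim0, fun j => j.elim0, fun j => j.elim0,
      fun j => j.elim0, fun j => j.elim0⟩⟩

/-- A hard family in dimension `D + 1` consists of a family of nearly orthogonal sign vectors,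
scaled down, and for each of them of a hard family in a complementary hyperplane. -/
theorem HasHardFamily.succ {k D : ℕ} {t ρ : ℝ} (ht : 1 ≤ t) (h : HasHardFamily k D t ρ) :
    HasHardFamily k (D + 1) t (((D + 1 : ℕ) : ℝ) / (4 * Real.log (2 * t)) * ρ) := by
  classical
  obtain ⟨κ, _, v, β, hβ, hc⟩ := h
  obtain ⟨G, hG, hGT⟩ := exists_signVectors_avoiding D.succ_pos ht
  have hD : (0 : ℝ) < (D + 1 : ℕ) := by positivity
  have hlog : 0 < Real.log (2 * t) := Real.log_pos (by linarith)
  set r : ℝ := ((D + 1 : ℕ) : ℝ) / (4 * Real.log (2 * t)) with hr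
  have hr0 : 0 < r := by positivity
  choose e hex he using fun g : G => exists_linearEquiv_of_mem_signVectors (hG g.2)
  choose P V x hV hPx hPy using hc
  -- There are only finitely many coreset maps, so one scale `η` is small enough for all of them.
  obtain ⟨η, hη, hηP⟩ : ∃ η : ℝ, 0 < η ∧ ∀ c hc (g g' : G),
      η ^ 2 * ∑ l, P c hc (e g g'.1).2 l ^ 2 ≤ 1 := by
    obtain ⟨K, hK⟩ := (Set.finite_range fun p : {c : Finset (κ × Fin k) → Finset (κ × Fin k) //
      ∀ V, c V ⊆ V ∧ ((c V).card : ℝ) ≤ t} × G × G =>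
        ∑ l, P p.1.1 p.1.2 (e p.2.1 p.2.2.1).2 l ^ 2).bddAbove
    refine ⟨(1 + |K|)⁻¹, by positivity, fun c hc g g' => ?_⟩
    have h1 : ∑ l, P c hc (e g g'.1).2 l ^ 2 ≤ K := hK ⟨(⟨c, hc⟩, g, g'), rfl⟩
    rw [inv_pow, inv_mul_le_iff₀ (by positivity)]
    nlinarith [le_abs_self K, abs_nonneg K]
  let v' : G ⊕ G × κ → Fin (D + 1) → ℝ :=
    Sum.elim (fun g => η • g.1) fun p => (e p.1).symm (0, v p.2)
  refine ⟨G ⊕ G × κ, inferInstance, v', Fin.cons (√r) β, ?_, fun c hcc => ?_⟩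
  · rw [Fin.prod_univ_succ]
    simp only [Fin.cons_zero, Fin.cons_succ]
    rw [hβ, Real.sq_sqrt hr0.le]
  -- The first set: all copies of the scaled sign vectors.
  let V₀ : Finset ((G ⊕ G × κ) × Fin k) :=
    Finset.univ.map (Function.Embedding.prodMap (Function.Embedding.inl (β := G × κ))
      (Function.Embedding.refl (Fin k)))
  have hV₀ : ∀ y ∈ c V₀, ∃ g : G, y.1 = Sum.inl g := by
    intro y hy
    obtain ⟨a, -, rfl⟩ := Finset.mem_map.1 ((hcc V₀).1 hy)
    exact ⟨a.1, rfl⟩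
  obtain ⟨g₀, hg₀, hgy⟩ := hGT
    (G.filter fun g => ∃ (hg : g ∈ G) (i : Fin k), (Sum.inl ⟨g, hg⟩, i) ∈ c V₀)
    (Finset.filter_subset _ _) (by
      refine le_trans ?_ (hcc V₀).2
      refine Nat.cast_le.2 (Finset.card_le_card_of_surjOn
        (fun y => Sum.elim (fun g => g.1) (fun _ => 0) y.1) ?_)
      intro g hg
      obtain ⟨-, hg, i, hi⟩ := Finset.mem_filter.1 hg
      exact ⟨_, hi, rfl⟩)
  let g₁ : G := ⟨g₀, hg₀⟩
  -- The coreset map on the family attached to the missed vector.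
  let ι : κ × Fin k ↪ (G ⊕ G × κ) × Fin k :=
    ⟨fun a => (Sum.inr (g₁, a.1), a.2), fun a b hab => by
      simp only [Prod.mk.injEq, Sum.inr.injEq, true_and] at hab
      exact Prod.ext hab.1 hab.2⟩
  let c' : Finset (κ × Fin k) → Finset (κ × Fin k) :=
    fun W => W.filter fun a => ι a ∈ c (W.map ι)
  have hc' : ∀ W, c' W ⊆ W ∧ ((c' W).card : ℝ) ≤ t := fun W => by
    refine ⟨Finset.filter_subset _ _, le_trans ?_ (hcc (W.map ι)).2⟩
    rw [← Finset.card_map ι]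
    refine Nat.cast_le.2 (Finset.card_le_card fun a ha => ?_)
    obtain ⟨b, hb, rfl⟩ := Finset.mem_map.1 ha
    exact (Finset.mem_filter.1 hb).2
  have ha0 : √r * η⁻¹ ≠ 0 := by positivity
  let Q : (Fin (D + 1) → ℝ) ≃ₗ[ℝ] (Fin (D + 1) → ℝ) :=
    (e g₁).trans (((LinearEquiv.smulOfNeZero ℝ ℝ _ ha0).prodCongr (P c' hc')).trans
      (Fin.consLinearEquiv ℝ fun _ : Fin (D + 1) => ℝ))
  have hQ : ∀ u, Q u = Fin.cons (√r * η⁻¹ * (e g₁ u).1) (P c' hc' (e g₁ u).2) := fun u => rfl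
  refine ⟨Q, Fin.cons V₀ fun j => (V c' hc' j).map ι,
    Fin.cons (Sum.inl g₁) fun j => Sum.inr (g₁, x c' hc' j), ?_, ?_, ?_⟩
  · refine Fin.cases (fun i => ?_) fun j i => ?_
    · exact Finset.mem_map.2 ⟨(g₁, i), Finset.mem_univ _, rfl⟩
    · exact Finset.mem_map.2 ⟨_, hV c' hc' j i, rfl⟩
  · refine Fin.cases ?_ fun j => ?_
    · have h1 : e g₁ (v' (Sum.inl g₁)) = (η, 0) := by
        change e g₁ (η • g₁.1) = _
        rw [map_smul, hex]
        simp
      simp only [Fin.cons_zero]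
      rw [hQ, h1]
      ext i
      refine Fin.cases ?_ (fun i => ?_) i
      · simp [hη.ne']
      · simp
    · have h1 : e g₁ (v' (Sum.inr (g₁, x c' hc' j))) = (0, v (x c' hc' j)) :=
        (e g₁).apply_symm_apply _
      simp only [Fin.cons_succ]
      rw [hQ, h1, hPx]
      ext i
      refine Fin.cases ?_ (fun i => ?_) i
      · simp [Fin.succ_ne_zero]
      · simp [Pi.single_apply]
  · refine Fin.cases (fun y hy => ?_) fun j y hy => ?_
    · obtain ⟨g, hg⟩ := hV₀ y hy
      have hgg : (g₀ ⬝ᵥ g.1) ^ 2 ≤ 4 * Real.log (2 * t) * (D + 1 : ℕ) :=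
        hgy g.1 (Finset.mem_filter.2 ⟨g.2, g.2, y.2, by
          have : (Sum.inl g, y.2) = y := by rw [← hg]
          rwa [← this] at hy⟩)
      have h1 : e g₁ (v' y.1) = (η * ((g₀ ⬝ᵥ g.1) / (D + 1 : ℕ)), η • (e g₁ g.1).2) := by
        rw [hg]
        change e g₁ (η • g.1) = _
        rw [map_smul]
        refine Prod.ext ?_ rfl
        rw [Prod.smul_fst, he, smul_eq_mul]
      rw [hQ, h1, Fin.sum_univ_succ]
      simp only [Fin.cons_zero, Fin.cons_succ, map_smul, Pi.smul_apply, smul_eq_mul, mul_pow]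
      rw [← Finset.mul_sum]
      have h2 := hηP c' hc' g₁ g
      have h3 : (√r) ^ 2 * η⁻¹ ^ 2 * (η ^ 2 * ((g₀ ⬝ᵥ g.1) / (D + 1 : ℕ)) ^ 2) ≤ 1 := by
        rw [Real.sq_sqrt hr0.le, hr]
        have : (g₀ ⬝ᵥ g.1) ^ 2 / (4 * Real.log (2 * t) * (D + 1 : ℕ)) ≤ 1 :=
          div_le_one_of_le₀ hgg (by positivity)
        refine le_of_eq_of_le ?_ this
        field_simp
      linarith
    · obtain ⟨a, ha, rfl⟩ := Finset.mem_map.1 ((hcc _).1 hy)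
      have h1 : e g₁ (v' (ι a).1) = (0, v a.1) := (e g₁).apply_symm_apply _
      have h2 := hPy c' hc' j a (Finset.mem_filter.2 ⟨ha, hy⟩)
      rw [hQ, h1, Fin.sum_univ_succ]
      simpa using h2

theorem hasHardFamily (k : ℕ) {t : ℝ} (ht : 1 ≤ t) (d : ℕ) :
    HasHardFamily k d t (d.factorial / (4 * Real.log (2 * t)) ^ d) := by
  induction d with
  | zero => simpa using hasHardFamily_zero k t
  | succ d ih =>
    convert ih.succ ht using 1
    rw [Nat.factorial_succ, Nat.cast_mul, pow_succ']
    exact mul_div_mul_comm _ _ _ _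

/-! ### From hard families to lower bounds on the factor -/

theorem detValue_le_opt {n d k : ℕ} (v : Fin n → Fin d → ℝ) {S W : Finset (Fin n)}
    (hSW : S ⊆ W) (hS : S.card = k) : detValue v S ≤ (opt k (mu v) W : ℝ) := by
  have : mu v S ≤ opt k (mu v) W :=
    Finset.le_sup (f := mu v) (Finset.mem_powersetCard.2 ⟨hSW, hS⟩)
  exact_mod_cast this

theorem mul_opt_le {n d k : ℕ} (v : Fin n → Fin d → ℝ) {W : Finset (Fin n)} {a b : ℝ}
    (hb : 0 ≤ b) (h : ∀ S ⊆ W, S.card = k → a * detValue v S ≤ b) :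
    a * (opt k (mu v) W : ℝ) ≤ b := by
  rcases (W.powersetCard k).eq_empty_or_nonempty with he | hne
  · simpa [opt, he] using hb
  · obtain ⟨S, hS, hmax⟩ := Finset.exists_mem_eq_sup _ hne (mu v)
    rw [Finset.mem_powersetCard] at hS
    rw [opt, hmax]
    exact h S hS.1 hS.2

theorem HasHardFamily.coresetFactorAtLeast {k d : ℕ} {t ρ : ℝ} (hd : 0 < d) (hdk : d ≤ k)
    (hρ : 0 < ρ) (h : HasHardFamily k d t ρ) : CoresetFactorAtLeast d k t (ρ / 4 ^ d) := by
  classical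
  obtain ⟨κ, _, v, β, hβ, hc⟩ := h
  let e := Fintype.equivFin (κ × Fin k)
  refine ⟨_, fun i => v (e.symm i).1, fun c α hct hcα => ?_⟩
  obtain ⟨P, V, x, hV, hPx, hPy⟩ := hc
    (fun W => (c (W.map e.toEmbedding)).map e.symm.toEmbedding) fun W => by
      refine ⟨fun a ha => ?_, ?_⟩
      · obtain ⟨b, hb, rfl⟩ := Finset.mem_map.1 ha
        obtain ⟨a', ha', rfl⟩ := Finset.mem_map.1 ((hct _).1 hb)
        simpa using ha'
      · rw [Finset.card_map]
        exact (hct _).2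
  have hd' : (0 : ℝ) < d := by exact_mod_cast hd
  have hk' : (0 : ℝ) < k := by exact_mod_cast hd.trans_le hdk
  set M := LinearMap.toMatrix' P.toLinearMap with hM
  have hMP : ∀ u, M.mulVec u = P u := fun u => LinearMap.toMatrix'_mulVec P.toLinearMap u
  set W := Finset.univ.biUnion fun j => (V j).map e.toEmbedding with hW
  set W' := Finset.univ.biUnion fun j => c ((V j).map e.toEmbedding) with hW'
  have hα : (opt k (mu fun i => v (e.symm i).1) W : ℝ) ≤
      α * (opt k (mu fun i => v (e.symm i).1) W' : ℝ) := hcα d _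
  -- `k` vectors of the whole union, spread evenly over the axes
  have hlow : ((k / d : ℕ) : ℝ) ^ d * ρ ≤
      M.det ^ 2 * (opt k (mu fun i => v (e.symm i).1) W : ℝ) := by
    let s : Fin k ↪ Fin (Fintype.card (κ × Fin k)) :=
      ⟨fun i => e (x ⟨i % d, Nat.mod_lt _ hd⟩, i), fun i j hij =>
        congrArg Prod.snd (e.injective hij)⟩
    have h1 := le_detValue_of_eq_single hd (fun i => M.mulVec (v (e.symm i).1)) s β fun i => by
      change M.mulVec (v (e.symm (e _)).1) = _
      rw [e.symm_apply_apply, hMP, hPx]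
    rw [hβ, detValue_mulVec] at h1
    refine h1.trans (mul_le_mul_of_nonneg_left (detValue_le_opt _ ?_ (by simp)) (sq_nonneg _))
    intro a ha
    obtain ⟨i, -, rfl⟩ := Finset.mem_map.1 ha
    exact Finset.mem_biUnion.2 ⟨_, Finset.mem_univ _, Finset.mem_map.2 ⟨_, hV _ i, rfl⟩⟩
  -- all rows have squared norm at most `2` in the coordinates `P`
  have hup : M.det ^ 2 * (opt k (mu fun i => v (e.symm i).1) W' : ℝ) ≤ (k * 2 / d) ^ d := by
    refine mul_opt_le _ (by positivity) fun S hS hSk => ?_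
    rw [← detValue_mulVec]
    refine detValue_le_of_sum_sq_le _ S hSk fun i hi => ?_
    obtain ⟨j, -, hj⟩ := Finset.mem_biUnion.1 (hS hi)
    simp only [hMP]
    exact hPy j (e.symm i) (Finset.mem_map.2 ⟨i, hj, rfl⟩)
  have hq : (k : ℝ) / (2 * d) ≤ (k / d : ℕ) := by
    have h1 : 1 ≤ k / d := (Nat.one_le_div_iff hd).2 hdk
    have h2 : k < (k / d + 1) * d := by
      rw [mul_comm]
      exact Nat.lt_mul_div_succ k hd
    have h3 : k ≤ k / d * (2 * d) := by nlinarith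
    rw [div_le_iff₀ (by positivity)]
    exact_mod_cast h3
  have hlow' : ((k : ℝ) / (2 * d)) ^ d * ρ ≤
      M.det ^ 2 * (opt k (mu fun i => v (e.symm i).1) W : ℝ) := by
    refine le_trans ?_ hlow
    gcongr
  have hpos : 0 < ((k : ℝ) / (2 * d)) ^ d * ρ := by positivity
  have hchain : ((k : ℝ) / (2 * d)) ^ d * ρ ≤
      α * (M.det ^ 2 * (opt k (mu fun i => v (e.symm i).1) W' : ℝ)) := by
    refine hlow'.trans ((mul_le_mul_of_nonneg_left hα (sq_nonneg _)).trans_eq ?_)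
    ring
  -- a negative `α` would make the optimum of the whole union vanish
  have hα0 : 0 ≤ α := by
    by_contra! hneg
    have : α * (M.det ^ 2 * (opt k (mu fun i => v (e.symm i).1) W' : ℝ)) ≤ 0 :=
      mul_nonpos_of_nonpos_of_nonneg hneg.le (by positivity)
    linarith
  have hfin := hchain.trans (mul_le_mul_of_nonneg_left hup hα0)
  rw [div_le_iff₀ (by positivity)]
  have h4 : ((k : ℝ) * 2 / d) ^ d = ((k : ℝ) / (2 * d)) ^ d * 4 ^ d := by
    rw [← mul_pow]
    congr 1
    field_simp
    norm_num
  rw [h4] at hfin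
  refine le_of_mul_le_mul_left (hfin.trans_eq ?_) (show 0 < ((k : ℝ) / (2 * d)) ^ d by positivity)
  ring

/-- Coresets with fewer than `k` elements have no finite factor: the coreset of a single set that
spans has no `k`-element subset at all. -/
theorem coresetFactorAtLeast_of_lt {d k : ℕ} {t : ℝ} (hdk : d ≤ k) (ht : t < k) (B : ℝ) :
    CoresetFactorAtLeast d k t B := by
  -- the standard basis of `ℝ^d`, followed by `k - d` zero vectors
  let v : Fin k → Fin d → ℝ := fun i j => if i = Fin.castLE hdk j then 1 else 0
  have hv : detValue v Finset.univ = 1 := by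
    rw [detValue, ← Matrix.det_one (n := Fin d) (R := ℝ)]
    congr 1
    ext a b
    rw [Matrix.sum_apply]
    simp [Matrix.vecMulVec_apply, v, Matrix.one_apply, eq_comm]
  refine ⟨k, v, fun c α hct hcα => ?_⟩
  have h := hcα 1 fun _ => Finset.univ
  have h1 : (1 : ℝ) ≤ opt k (mu v) (Finset.univ.biUnion fun _ : Fin 1 => Finset.univ) := by
    rw [← hv]
    exact detValue_le_opt _ (by simp) (by simp)
  have h2 : opt k (mu v) (Finset.univ.biUnion fun _ : Fin 1 => c Finset.univ) = 0 := by
    have hlt : (c Finset.univ).card < k := by exact_mod_cast (hct Finset.univ).2.trans_lt ht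
    rw [Finset.univ_unique, Finset.singleton_biUnion, opt, Finset.powersetCard_eq_empty.2 hlt]
    simp
  rw [h2] at h
  simp only [NNReal.coe_zero, mul_zero] at h
  linarith

theorem CoresetFactorAtLeast.mono {d k : ℕ} {t B B' : ℝ} (h : CoresetFactorAtLeast d k t B')
    (hB : B ≤ B') : CoresetFactorAtLeast d k t B := by
  obtain ⟨n, v, hv⟩ := h
  exact ⟨n, v, fun c α hc hα => hB.trans (hv c α hc hα)⟩

/-- The explicit bound behind all three asymptotic ones. If `γ' < 1` the coresets have fewer than
`k` elements; otherwise `1 ≤ γ * γ'`, and `log (2 k ^ γ') ≤ 2 γ γ' log d`. The constant is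
`96 = 3 * 4 * 4 * 2`, from `d! ≥ (d / 3) ^ d`, the Chernoff bound, the comparison of the two optima
and the last inequality. -/
theorem coresetFactorAtLeast_of_le {d k : ℕ} {γ γ' B : ℝ} (hd : 2 ≤ d) (hdk : d ≤ k)
    (hkd : (k : ℝ) ≤ (d : ℝ) ^ γ) (hγ' : 0 < γ')
    (hB : 1 ≤ γ * γ' → B ≤ ((d : ℝ) / (96 * (γ * γ') * Real.log d)) ^ d) :
    CoresetFactorAtLeast d k ((k : ℝ) ^ γ') B := by
  have hd' : (2 : ℝ) ≤ d := by exact_mod_cast hd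
  have hdk' : (d : ℝ) ≤ k := by exact_mod_cast hdk
  have hγ : 1 ≤ γ := by
    rw [← Real.rpow_le_rpow_left_iff (show (1 : ℝ) < d by linarith), Real.rpow_one]
    exact hdk'.trans hkd
  rcases lt_or_ge γ' 1 with h1 | h1
  · refine coresetFactorAtLeast_of_lt hdk ?_ B
    calc (k : ℝ) ^ γ' < (k : ℝ) ^ (1 : ℝ) := Real.rpow_lt_rpow_of_exponent_lt (by linarith) h1
      _ = k := Real.rpow_one _
  · have hγγ : 1 ≤ γ * γ' := one_le_mul_of_one_le_of_one_le hγ h1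
    have hk0 : (0 : ℝ) < k := by linarith
    have ht : 1 ≤ (k : ℝ) ^ γ' := Real.one_le_rpow (by linarith) hγ'.le
    have hlogd : 0 < Real.log d := Real.log_pos (by linarith)
    have hlog : 0 < Real.log (2 * (k : ℝ) ^ γ') := Real.log_pos (by linarith)
    have hlogle : Real.log (2 * (k : ℝ) ^ γ') ≤ 2 * (γ * γ') * Real.log d := by
      rw [Real.log_mul (by norm_num) (by positivity), Real.log_rpow hk0]
      have h2 : Real.log k ≤ γ * Real.log d := by
        rw [← Real.log_rpow (by linarith)]
        exact Real.log_le_log hk0 hkd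
      have h3 : Real.log 2 ≤ Real.log d := Real.log_le_log (by norm_num) hd'
      nlinarith
    refine ((hasHardFamily k ht d).coresetFactorAtLeast (by omega) hdk (by positivity)).mono
      ((hB hγγ).trans ?_)
    have hfact : ((d : ℝ) / 3) ^ d ≤ d.factorial := by
      have h2 := Real.pow_div_factorial_le_exp d (by positivity) d
      have h3 : Real.exp d ≤ 3 ^ d := by
        rw [← mul_one (d : ℝ), Real.exp_nat_mul]
        gcongr
        exact Real.exp_one_lt_three.le
      rw [div_le_iff₀ (by positivity)] at h2
      rw [div_pow, div_le_iff₀ (by positivity)]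
      nlinarith [show (0 : ℝ) < d.factorial by positivity]
    calc ((d : ℝ) / (96 * (γ * γ') * Real.log d)) ^ d
        = ((d : ℝ) / 3 / (4 * (2 * (2 * (γ * γ') * Real.log d))* 2)) ^ d := by
          congr 1
          rw [div_div]
          ring_nf
      _ ≤ ((d : ℝ) / 3 / (4 * Real.log (2 * (k : ℝ) ^ γ') * 4)) ^ d := by
          gcongr ((d : ℝ) / 3 / ?_) ^ d
          linarith
      _ ≤ d.factorial / (4 * Real.log (2 * (k : ℝ) ^ γ')) ^ d / 4 ^ d := by
          rw [div_pow, mul_pow, div_div]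
          gcongr

/-! ### Asymptotics -/

/-- Trading a factor `a` in the base for a factor `1 - ε` in the exponent. -/
theorem rpow_le_div_pow {d : ℕ} {y a ε : ℝ} (hy : 0 < y) (ha : 0 < a)
    (h : Real.log a ≤ ε * Real.log y) : y ^ ((d : ℝ) * (1 - ε)) ≤ (y / a) ^ d := by
  rw [mul_comm, Real.rpow_mul hy.le, Real.rpow_natCast]
  refine pow_le_pow_left₀ (by positivity) ?_ d
  rw [← Real.log_le_log_iff (by positivity) (by positivity), Real.log_rpow hy,
    Real.log_div hy.ne' ha.ne']
  linarith

theorem tendsto_log_natCast_atTop : Tendsto (fun d : ℕ => Real.log d) atTop atTop :=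
  Real.tendsto_log_atTop.comp tendsto_natCast_atTop_atTop

theorem eventually_const_mul_log_le (C : ℝ) :
    ∀ᶠ d : ℕ in atTop, 0 < C → Real.log (C * Real.log d) ≤ 2 * Real.log (Real.log d) := by
  filter_upwards [tendsto_log_natCast_atTop.eventually_ge_atTop (max C 1)] with d hd hC
  have h1 : 1 ≤ Real.log d := (le_max_right _ _).trans hd
  have h2 : C ≤ Real.log d := (le_max_left _ _).trans hd
  rw [Real.log_mul hC.ne' (by linarith)]
  linarith [Real.log_le_log hC h2]

end DetCoreset

open DetCoreset in
theorem mainTheorem4 :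
    -- general bound
    (∀ b : ℕ → ℝ, (b =o[atTop] fun d : ℕ => (d : ℝ) / Real.log d ^ 2) →
      ∃ ε : ℕ → ℝ, Tendsto ε atTop (𝓝 0) ∧ ∀ᶠ d : ℕ in atTop,
        ∀ (k : ℕ) (γ γ' : ℝ), d ≤ k → (k : ℝ) ≤ (d : ℝ) ^ γ → 0 < γ' → γ * γ' ≤ b d →
          DetCoreset.CoresetFactorAtLeast d k ((k : ℝ) ^ γ')
            (((d : ℝ) / (γ * γ' * Real.log d ^ 2)) ^ ((d : ℝ) * (1 - ε d)))) ∧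
    -- the logarithms are absorbed by the exponent
    (∀ b : ℕ → ℝ, (b =o[atTop] fun d : ℕ => (d : ℝ) / Real.log d ^ 2) →
      ((fun d : ℕ => Real.log (Real.log d)) =o[atTop] fun d : ℕ => Real.log ((d : ℝ) / b d)) →
      ∃ ε : ℕ → ℝ, Tendsto ε atTop (𝓝 0) ∧ ∀ᶠ d : ℕ in atTop,
        ∀ (k : ℕ) (γ γ' : ℝ), d ≤ k → (k : ℝ) ≤ (d : ℝ) ^ γ → 0 < γ' → γ * γ' ≤ b d →
          DetCoreset.CoresetFactorAtLeast d k ((k : ℝ) ^ γ')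
            (((d : ℝ) / (γ * γ')) ^ ((d : ℝ) * (1 - ε d)))) ∧
    -- constant exponents
    (∀ γ γ' : ℝ, 0 < γ' →
      ∃ ε : ℕ → ℝ, Tendsto ε atTop (𝓝 0) ∧ ∀ᶠ d : ℕ in atTop,
        ∀ k : ℕ, d ≤ k → (k : ℝ) ≤ (d : ℝ) ^ γ →
          DetCoreset.CoresetFactorAtLeast d k ((k : ℝ) ^ γ')
            ((d : ℝ) ^ ((d : ℝ) * (1 - ε d)))) := by
  refine ⟨fun b _ => ?_, fun b hb hlog => ?_, fun γ γ' hγ' => ?_⟩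
  · -- The recursive instance loses only one factor `log d`, so that the second one beats the
    -- constant and no error term is needed.
    refine ⟨0, tendsto_const_nhds, ?_⟩
    filter_upwards [eventually_ge_atTop 2, tendsto_log_natCast_atTop.eventually_ge_atTop 96]
      with d hd hlogd k γ γ' hdk hkd hγ' _
    refine coresetFactorAtLeast_of_le hd hdk hkd hγ' fun hγγ => ?_
    rw [Pi.zero_apply, sub_zero, mul_one, Real.rpow_natCast]
    refine pow_le_pow_left₀ (by positivity)
      (div_le_div_of_nonneg_left (by positivity) (by positivity) ?_) d
    calc 96 * (γ * γ') * Real.log d = γ * γ' * Real.log d * 96 := by ring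
      _ ≤ γ * γ' * Real.log d * Real.log d := by gcongr
      _ = γ * γ' * Real.log d ^ 2 := by ring
  · refine ⟨fun d => 2 * (Real.log (Real.log d) / Real.log (d / b d)), ?_, ?_⟩
    · simpa using hlog.tendsto_div_nhds_zero.const_mul 2
    filter_upwards [eventually_ge_atTop 2, tendsto_log_natCast_atTop.eventually_ge_atTop 2,
      eventually_const_mul_log_le 96, hb.bound zero_lt_one]
      with d hd hlogd hC hbd k γ γ' hdk hkd hγ' hγb
    refine coresetFactorAtLeast_of_le hd hdk hkd hγ' fun hγγ => ?_
    have hd' : (0 : ℝ) < d := by positivity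
    have hb1 : 1 ≤ b d := hγγ.trans hγb
    have hb0 : 0 < b d := by linarith
    have hz : 1 < (d : ℝ) / b d := by
      rw [one_mul, Real.norm_of_nonneg hb0.le, Real.norm_of_nonneg (by positivity),
        le_div_iff₀ (by positivity)] at hbd
      rw [lt_div_iff₀ hb0]
      nlinarith [mul_le_mul_of_nonneg_left (pow_le_pow_left₀ zero_le_two hlogd 2) hb0.le]
    have hlz : 0 < Real.log (d / b d) := Real.log_pos hz
    have hll : 0 ≤ Real.log (Real.log d) := Real.log_nonneg (by linarith)
    have hzy : Real.log (d / b d) ≤ Real.log (d / (γ * γ')) :=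
      Real.log_le_log (by linarith) (by gcongr)
    refine (rpow_le_div_pow (a := 96 * Real.log d) (by positivity) (by positivity) ?_).trans_eq ?_
    · calc Real.log (96 * Real.log d) ≤ 2 * Real.log (Real.log d) := hC (by norm_num)
        _ = 2 * (Real.log (Real.log d) / Real.log (d / b d)) * Real.log (d / b d) := by
          field_simp
        _ ≤ _ := by gcongr
    · rw [div_div]
      ring_nf
  · refine ⟨fun d => 2 * (Real.log (Real.log d) / Real.log d), ?_, ?_⟩
    · simpa using (Real.isLittleO_log_id_atTop.comp_tendsto
        tendsto_log_natCast_atTop).tendsto_div_nhds_zero.const_mul 2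
    filter_upwards [eventually_ge_atTop 2, tendsto_log_natCast_atTop.eventually_ge_atTop 2,
      eventually_const_mul_log_le (96 * (γ * γ'))] with d hd hlogd hC k hdk hkd
    refine coresetFactorAtLeast_of_le hd hdk hkd hγ' fun hγγ => ?_
    have hpos : 0 < 96 * (γ * γ') := by linarith
    refine rpow_le_div_pow (by positivity) (by positivity) ((hC hpos).trans_eq ?_)
    field_simp
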